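/- Let $D\subset\mathbb{C}^n$ be a bounded homogeneous domain (a bounded connected open set whose group of biholomorphic self-maps acts transitively) with $0\in D$. Let $K(z,\zeta)$ be the Bergman kernel of $D$ and let $$H_z(u,\overline v)=\sum_{i,j=1}^n \frac{\partial^2\log K(z,z)}{\partial z_i\,\partial\overline{z}_j}\,u_i\overline{v_j}$$ be its Bergman metric. For $f$ holomorphic on $D$ put $$\beta_f=\sup_{z\in D}\ \sup_{u\in\mathbb{C}^n\setminus\{0\}}\frac{\left|\sum_{k=1}^n\frac{\partial f}{\partial z_k}(z)u_k\right|}{H_z(u,\overline u)^{1/2}},$$ and let $\mathcal{B}(D)$ be the Bloch space of all holomorphic $f$ on $D$ with $\beta_f<\infty$, normed by $\|f\|_{\mathcal B}=|f(0)|+\beta_f$. Let $\mu:D\to(0,\infty)$ be continuous, put $\|f\|_\mu=\sup_{z\in D}\mu(z)|f(z)|\in[0,\infty]$ for $f$ holomorphic on $D$, and let $H^\infty_\mu(D)$ be the space of all holomorphic $f$ on $D$ with $\|f\|_\mu<\infty$, with norm $\|\cdot\|_\mu$. Let $\psi:D\to\mathbb{C}$ and $\varphi:D\to D$ be holomorphic,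 and let $W_{\psi,\varphi}f=\psi\,(f\circ\varphi)$. Then $W_{\psi,\varphi}$ is a compact operator from $\mathcal{B}(D)$ to $H^\infty_\mu(D)$ (that is, it maps $\mathcal{B}(D)$ into $H^\infty_\mu(D)$ and is compact as a linear operator between these normed spaces) if and only if for every bounded sequence $(f_k)$ in $\mathcal{B}(D)$ converging to $0$ locally uniformly in $D$, the sequence $\|\psi(f_k\circ\varphi)\|_\mu$ converges to $0$ as $k\to\infty$. -/

import Mathlib

open Filter Topology MeasureTheory
open scoped ENNReal ComplexConjugate

noncomputable section

namespace BlochWCO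

/-- A bounded homogeneous domain in `ℂⁿ` containing the origin: a bounded connected open set on
which the group of biholomorphic self-maps acts transitively. -/
structure BoundedHomogeneousDomain (n : ℕ) where
  carrier : Set (Fin n → ℂ)
  isOpen : IsOpen carrier
  isConnected : IsConnected carrier
  isBounded : Bornology.IsBounded carrier
  homogeneous : ∀ z ∈ carrier, ∀ w ∈ carrier, ∃ g h : (Fin n → ℂ) → (Fin n → ℂ),
    DifferentiableOn ℂ g carrier ∧ Set.MapsTo g carrier carrier ∧
    DifferentiableOn ℂ h carrier ∧ Set.MapsTo h carrier carrier ∧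
    Set.InvOn h g carrier carrier ∧ g z = w
  zero_mem : (0 : Fin n → ℂ) ∈ carrier

variable {n : ℕ}

/-- The space `H(D)` of holomorphic functions on `D`, each represented by its extension by `0` to
all of `ℂⁿ`, so that two of them are equal exactly when they agree on `D`. -/
structure HolFun (D : BoundedHomogeneousDomain n) where
  toFun : (Fin n → ℂ) → ℂ
  differentiableOn : DifferentiableOn ℂ toFun D.carrier
  eq_zero : ∀ z, z ∉ D.carrier → toFun z = 0

namespace HolFun

variable {D : BoundedHomogeneousDomain n}

instance : CoeFun (HolFun D) (fun _ => (Fin n → ℂ) → ℂ) := ⟨toFun⟩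

theorem toFun_injective :
    Function.Injective (toFun : HolFun D → (Fin n → ℂ) → ℂ) := by
  rintro ⟨f, _, _⟩ ⟨g, _, _⟩ h
  cases h
  rfl

theorem ext_on {f g : HolFun D} (h : ∀ z ∈ D.carrier, f z = g z) : f = g := by
  refine toFun_injective (funext fun z => ?_)
  by_cases hz : z ∈ D.carrier
  · exact h z hz
  · exact (f.eq_zero z hz).trans (g.eq_zero z hz).symm

theorem differentiableAt (f : HolFun D) {z : Fin n → ℂ} (hz : z ∈ D.carrier) :
    DifferentiableAt ℂ (⇑f) z :=
  f.differentiableOn.differentiableAt (D.isOpen.mem_nhds hz)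

instance : Zero (HolFun D) := ⟨⟨0, differentiableOn_const (0 : ℂ), fun _ _ => rfl⟩⟩

instance : Add (HolFun D) := ⟨fun f g =>
  ⟨⇑f + ⇑g, f.differentiableOn.add g.differentiableOn, fun z hz => by
    rw [Pi.add_apply, f.eq_zero z hz, g.eq_zero z hz, add_zero]⟩⟩

instance : Neg (HolFun D) := ⟨fun f =>
  ⟨-⇑f, f.differentiableOn.neg, fun z hz => by
    rw [Pi.neg_apply, f.eq_zero z hz, neg_zero]⟩⟩

instance : Sub (HolFun D) := ⟨fun f g =>
  ⟨⇑f - ⇑g, f.differentiableOn.sub g.differentiableOn, fun z hz => by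
    rw [Pi.sub_apply, f.eq_zero z hz, g.eq_zero z hz, sub_zero]⟩⟩

instance : SMul ℂ (HolFun D) := ⟨fun c f =>
  ⟨c • ⇑f, f.differentiableOn.const_smul c, fun z hz => by
    rw [Pi.smul_apply, f.eq_zero z hz, smul_zero]⟩⟩

instance : SMul ℕ (HolFun D) := ⟨fun c f =>
  ⟨c • ⇑f, f.differentiableOn.const_smul c, fun z hz => by
    rw [Pi.smul_apply, f.eq_zero z hz, smul_zero]⟩⟩

instance : SMul ℤ (HolFun D) := ⟨fun c f =>
  ⟨c • ⇑f, f.differentiableOn.const_smul c, fun z hz => by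
    rw [Pi.smul_apply, f.eq_zero z hz, smul_zero]⟩⟩

theorem coe_zero : (⇑(0 : HolFun D) : (Fin n → ℂ) → ℂ) = 0 := rfl
theorem coe_add (f g : HolFun D) : (⇑(f + g) : (Fin n → ℂ) → ℂ) = ⇑f + ⇑g := rfl
theorem coe_smul (c : ℂ) (f : HolFun D) : (⇑(c • f) : (Fin n → ℂ) → ℂ) = c • ⇑f := rfl

instance : AddCommGroup (HolFun D) :=
  toFun_injective.addCommGroup _ rfl (fun _ _ => rfl) (fun _ => rfl) (fun _ _ => rfl)
    (fun _ _ => rfl) (fun _ _ => rfl)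

instance : Module ℂ (HolFun D) :=
  toFun_injective.module ℂ ⟨⟨toFun, rfl⟩, fun _ _ => rfl⟩ (fun _ _ => rfl)

end HolFun

/-- The space `S(D)` of holomorphic self-maps of `D`; only the values on `D` matter. -/
structure HolSelfMap (D : BoundedHomogeneousDomain n) where
  toFun : (Fin n → ℂ) → (Fin n → ℂ)
  differentiableOn : DifferentiableOn ℂ toFun D.carrier
  mapsTo : Set.MapsTo toFun D.carrier D.carrier

/-- A weight: a continuous, strictly positive function on `D`; only the values on `D` matter. -/
structure Weight (D : BoundedHomogeneousDomain n) where
  toFun : (Fin n → ℂ) → ℝ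
  continuousOn : ContinuousOn toFun D.carrier
  pos : ∀ z ∈ D.carrier, 0 < toFun z

section Bergman

variable (D : BoundedHomogeneousDomain n)

/-- The Bergman space `A²(D)` of square-integrable holomorphic functions on `D`. -/
def BergmanSpace : Set (HolFun D) := {f | MemLp (⇑f) 2 (volume.restrict D.carrier)}

/-- `k ∈ A²(D)` represents evaluation at `z`: `f(z) = ⟨f, k⟩` for all `f ∈ A²(D)`. -/
def RepresentsEval (z : Fin n → ℂ) (k : HolFun D) : Prop :=
  k ∈ BergmanSpace D ∧ ∀ f ∈ BergmanSpace D, f z = ∫ ζ in D.carrier, f ζ * conj (k ζ)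

/-- The Bergman kernel `K(z, ζ)`, `z, ζ ∈ D`: the conjugate of `k_z(ζ)`, where `k_z` is the unique
element of `A²(D)` that represents evaluation at `z` (it exists by the Riesz representation
theorem). -/
def bergmanKernel (z ζ : Fin n → ℂ) : ℂ :=
  conj ((Classical.epsilon (RepresentsEval D z) : HolFun D) ζ)

/-- The Wirtinger derivative `∂F/∂z_i`. -/
def wirtinger (i : Fin n) (F : (Fin n → ℂ) → ℂ) (z : Fin n → ℂ) : ℂ :=
  (1 / 2) * (fderiv ℝ F z (Pi.single i 1) - Complex.I * fderiv ℝ F z (Pi.single i Complex.I))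

/-- The Wirtinger derivative `∂F/∂z̄_i`. -/
def wirtingerBar (i : Fin n) (F : (Fin n → ℂ) → ℂ) (z : Fin n → ℂ) : ℂ :=
  (1 / 2) * (fderiv ℝ F z (Pi.single i 1) + Complex.I * fderiv ℝ F z (Pi.single i Complex.I))

/-- The coefficients `g_ij(z) = ∂²/∂z_i ∂z̄_j log K(z, z)` of the Bergman metric. -/
def bergmanCoeff (i j : Fin n) (z : Fin n → ℂ) : ℂ :=
  wirtinger i (wirtingerBar j fun w => ((Real.log (bergmanKernel D w w).re : ℝ) : ℂ)) z

/-- The Bergman metric: `bergmanMetric D z u v` is `H_z(u, v̄) = ∑ g_ij(z) u_i v̄_j`. -/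
def bergmanMetric (z u v : Fin n → ℂ) : ℂ :=
  ∑ i, ∑ j, bergmanCoeff D i j z * u i * conj (v j)

end Bergman

section Bloch

variable {D : BoundedHomogeneousDomain n}

/-- `Q_f(z) = sup_{u ≠ 0} |∇f(z) u| / H_z(u, ū)^{1/2}`. -/
def blochQ (f : HolFun D) (z : Fin n → ℂ) : ℝ≥0∞ :=
  ⨆ u : Fin n → ℂ, ⨆ _ : u ≠ 0,
    ‖fderiv ℂ (⇑f) z u‖ₑ / ENNReal.ofReal (Real.sqrt (bergmanMetric D z u u).re)

/-- `β_f = sup_{z ∈ D} Q_f(z)`. -/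
def blochBeta (f : HolFun D) : ℝ≥0∞ := ⨆ z ∈ D.carrier, blochQ f z

theorem blochBeta_add_le (f g : HolFun D) :
    blochBeta (f + g) ≤ blochBeta f + blochBeta g := by
  refine iSup₂_le fun z hz => iSup₂_le fun u hu => ?_
  have h1 : fderiv ℂ (⇑(f + g)) z u = fderiv ℂ (⇑f) z u + fderiv ℂ (⇑g) z u := by
    rw [HolFun.coe_add, fderiv_add (f.differentiableAt hz) (g.differentiableAt hz)]
    rfl
  have hle : ∀ h : HolFun D,
      ‖fderiv ℂ (⇑h) z u‖ₑ / ENNReal.ofReal (Real.sqrt (bergmanMetric D z u u).re)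
        ≤ blochBeta h := fun h =>
    le_trans (le_iSup₂_of_le u hu le_rfl) (le_iSup₂ (f := fun z _ => blochQ h z) z hz)
  rw [h1]
  calc _ ≤ (‖fderiv ℂ (⇑f) z u‖ₑ + ‖fderiv ℂ (⇑g) z u‖ₑ)
          / ENNReal.ofReal (Real.sqrt (bergmanMetric D z u u).re) :=
        ENNReal.div_le_div_right (enorm_add_le _ _) _
    _ ≤ _ := by
        rw [ENNReal.add_div]
        exact add_le_add (hle f) (hle g)

theorem blochBeta_smul (c : ℂ) (f : HolFun D) :
    blochBeta (c • f) = ‖c‖ₑ * blochBeta f := by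
  simp only [blochBeta, blochQ, ENNReal.mul_iSup]
  refine iSup_congr fun z => iSup_congr fun hz => iSup_congr fun u => iSup_congr fun _ => ?_
  have h1 : fderiv ℂ (⇑(c • f)) z u = c • fderiv ℂ (⇑f) z u := by
    rw [HolFun.coe_smul, fderiv_const_smul (f.differentiableAt hz)]
    rfl
  rw [h1, enorm_smul, mul_div_assoc]

theorem blochBeta_zero : blochBeta (0 : HolFun D) = 0 := by
  have := blochBeta_smul (0 : ℂ) (0 : HolFun D)
  simpa using this

theorem eq_zero_of_blochBeta_eq_zero (f : HolFun D) (h : blochBeta f = 0) (h0 : f 0 = 0) :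
    f = 0 := by
  have hd : ∀ z ∈ D.carrier, fderiv ℂ (⇑f) z = 0 := by
    intro z hz
    refine ContinuousLinearMap.ext fun u => ?_
    by_cases hu : u = 0
    · simp [hu]
    · have h2 : blochQ f z = 0 := (ENNReal.iSup_eq_zero.1 (ENNReal.iSup_eq_zero.1 h z)) hz
      have h3 := (ENNReal.iSup_eq_zero.1 (ENNReal.iSup_eq_zero.1 h2 u)) hu
      rcases ENNReal.div_eq_zero_iff.1 h3 with h4 | h4
      · simpa using h4
      · exact absurd h4 ENNReal.ofReal_ne_top
  refine HolFun.ext_on fun z hz => ?_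
  rw [D.isOpen.is_const_of_fderiv_eq_zero D.isConnected.isPreconnected f.differentiableOn
    (fun w hw => hd w hw) hz D.zero_mem]
  exact h0

variable (D)

/-- The Bloch space `ℬ(D)`: holomorphic functions with `β_f < ∞`. -/
def BlochSpace : Submodule ℂ (HolFun D) where
  carrier := {f | blochBeta f < ⊤}
  add_mem' := fun {f g} hf hg =>
    (blochBeta_add_le f g).trans_lt (ENNReal.add_lt_top.2 ⟨hf, hg⟩)
  zero_mem' := by simp [blochBeta_zero]
  smul_mem' := fun c f hf => by
    change blochBeta (c • f) < ⊤
    rw [blochBeta_smul]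
    exact ENNReal.mul_lt_top enorm_lt_top hf

/-- The Bloch norm `‖f‖ = |f(0)| + β_f`. -/
instance : Norm (BlochSpace D) := ⟨fun f => ‖f.1 0‖ + (blochBeta f.1).toReal⟩

theorem bloch_norm_def (f : BlochSpace D) : ‖f‖ = ‖f.1 0‖ + (blochBeta f.1).toReal := rfl

theorem bloch_core : NormedSpace.Core ℂ (BlochSpace D) where
  norm_nonneg f := by rw [bloch_norm_def]; positivity
  norm_smul c f := by
    simp only [bloch_norm_def, Submodule.coe_smul, blochBeta_smul, ENNReal.toReal_mul,
      toReal_enorm, HolFun.coe_smul, Pi.smul_apply, norm_smul]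
    ring
  norm_triangle f g := by
    simp only [bloch_norm_def]
    have h1 : ‖(f + g).1 0‖ ≤ ‖f.1 0‖ + ‖g.1 0‖ := norm_add_le (f.1 0) (g.1 0)
    have h2 : (blochBeta (f + g).1).toReal ≤ (blochBeta f.1).toReal + (blochBeta g.1).toReal := by
      rw [← ENNReal.toReal_add f.2.ne g.2.ne]
      exact ENNReal.toReal_mono (ENNReal.add_lt_top.2 ⟨f.2, g.2⟩).ne (blochBeta_add_le f.1 g.1)
    linarith
  norm_eq_zero_iff f := by
    rw [bloch_norm_def]
    constructor
    · intro h
      have h1 : ‖f.1 0‖ = 0 := le_antisymm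
        (by have := ENNReal.toReal_nonneg (a := blochBeta f.1); linarith) (norm_nonneg _)
      have h2 : (blochBeta f.1).toReal = 0 := by linarith
      have h3 : blochBeta f.1 = 0 := by
        rcases (ENNReal.toReal_eq_zero_iff _).1 h2 with h | h
        · exact h
        · exact absurd h f.2.ne
      exact Subtype.ext (eq_zero_of_blochBeta_eq_zero f.1 h3 (norm_eq_zero.1 h1))
    · rintro rfl
      simp [blochBeta_zero, HolFun.coe_zero]

instance : NormedAddCommGroup (BlochSpace D) := NormedAddCommGroup.ofCore (bloch_core D)

instance : NormedSpace ℂ (BlochSpace D) := NormedSpace.ofCore (bloch_core D)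

end Bloch

section WeightedHinf

variable {D : BoundedHomogeneousDomain n}

/-- `‖f‖_μ = sup_{z ∈ D} μ(z) |f(z)|`, with value `∞` if the supremum is infinite. -/
def muNorm (μ : Weight D) (f : HolFun D) : ℝ≥0∞ :=
  ⨆ z ∈ D.carrier, ENNReal.ofReal (μ.toFun z) * ‖f z‖ₑ

theorem muNorm_add_le (μ : Weight D) (f g : HolFun D) :
    muNorm μ (f + g) ≤ muNorm μ f + muNorm μ g := by
  refine iSup₂_le fun z hz => ?_
  have hle : ∀ h : HolFun D, ENNReal.ofReal (μ.toFun z) * ‖h z‖ₑ ≤ muNorm μ h := fun h =>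
    le_iSup₂ (f := fun z _ => ENNReal.ofReal (μ.toFun z) * ‖h z‖ₑ) z hz
  calc _ ≤ ENNReal.ofReal (μ.toFun z) * (‖f z‖ₑ + ‖g z‖ₑ) := by
        gcongr
        exact enorm_add_le (f z) (g z)
    _ ≤ _ := by
        rw [mul_add]
        exact add_le_add (hle f) (hle g)

theorem muNorm_smul (μ : Weight D) (c : ℂ) (f : HolFun D) :
    muNorm μ (c • f) = ‖c‖ₑ * muNorm μ f := by
  simp only [muNorm, ENNReal.mul_iSup]
  refine iSup_congr fun z => iSup_congr fun _ => ?_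
  rw [HolFun.coe_smul, Pi.smul_apply, enorm_smul, mul_left_comm]

theorem muNorm_zero (μ : Weight D) : muNorm μ (0 : HolFun D) = 0 := by
  have := muNorm_smul μ (0 : ℂ) (0 : HolFun D)
  simpa using this

theorem eq_zero_of_muNorm_eq_zero (μ : Weight D) (f : HolFun D) (h : muNorm μ f = 0) :
    f = 0 := by
  refine HolFun.ext_on fun z hz => ?_
  have h1 := (ENNReal.iSup_eq_zero.1 (ENNReal.iSup_eq_zero.1 h z)) hz
  rcases mul_eq_zero.1 h1 with h2 | h2
  · exact absurd (ENNReal.ofReal_eq_zero.1 h2) (not_le.2 (μ.pos z hz))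
  · exact enorm_eq_zero.1 h2

/-- The weighted space `H^∞_μ(D)`: holomorphic functions with `sup_{z ∈ D} μ(z) |f(z)| < ∞`. -/
def WeightedHinf (μ : Weight D) : Submodule ℂ (HolFun D) where
  carrier := {f | muNorm μ f < ⊤}
  add_mem' := fun {f g} hf hg =>
    (muNorm_add_le μ f g).trans_lt (ENNReal.add_lt_top.2 ⟨hf, hg⟩)
  zero_mem' := by simp [muNorm_zero]
  smul_mem' := fun c f hf => by
    change muNorm μ (c • f) < ⊤
    rw [muNorm_smul]
    exact ENNReal.mul_lt_top enorm_lt_top hf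

instance (μ : Weight D) : Norm (WeightedHinf μ) := ⟨fun f => (muNorm μ f.1).toReal⟩

theorem weightedHinf_norm_def (μ : Weight D) (f : WeightedHinf μ) :
    ‖f‖ = (muNorm μ f.1).toReal := rfl

theorem weightedHinf_core (μ : Weight D) : NormedSpace.Core ℂ (WeightedHinf μ) where
  norm_nonneg f := by rw [weightedHinf_norm_def]; positivity
  norm_smul c f := by
    simp only [weightedHinf_norm_def, Submodule.coe_smul, muNorm_smul, ENNReal.toReal_mul,
      toReal_enorm]
  norm_triangle f g := by
    simp only [weightedHinf_norm_def]
    rw [← ENNReal.toReal_add f.2.ne g.2.ne]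
    exact ENNReal.toReal_mono (ENNReal.add_lt_top.2 ⟨f.2, g.2⟩).ne (muNorm_add_le μ f.1 g.1)
  norm_eq_zero_iff f := by
    rw [weightedHinf_norm_def]
    constructor
    · intro h
      rcases (ENNReal.toReal_eq_zero_iff _).1 h with h | h
      · exact Subtype.ext (eq_zero_of_muNorm_eq_zero μ f.1 h)
      · exact absurd h f.2.ne
    · rintro rfl
      simp [muNorm_zero]

instance (μ : Weight D) : NormedAddCommGroup (WeightedHinf μ) :=
  NormedAddCommGroup.ofCore (weightedHinf_core μ)

instance (μ : Weight D) : NormedSpace ℂ (WeightedHinf μ) :=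
  NormedSpace.ofCore (weightedHinf_core μ)

end WeightedHinf

section Operator

variable {D : BoundedHomogeneousDomain n}

/-- The weighted composition operator `W_{ψ,φ} f = ψ (f ∘ φ)` on `H(D)`. -/
def weightedComp (ψ : HolFun D) (φ : HolSelfMap D) : HolFun D →ₗ[ℂ] HolFun D where
  toFun f := ⟨fun z => ψ z * f (φ.toFun z),
    ψ.differentiableOn.mul (f.differentiableOn.comp φ.differentiableOn φ.mapsTo),
    fun z hz => by simp only [ψ.eq_zero z hz, zero_mul]⟩
  map_add' f g := HolFun.ext_on fun z _ => mul_add (ψ z) (f (φ.toFun z)) (g (φ.toFun z))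
  map_smul' c f := HolFun.ext_on fun z _ => mul_left_comm (ψ z) c (f (φ.toFun z))

/-- `W_{ψ,φ} : ℬ(D) → H^∞_μ(D)` is compact: `W_{ψ,φ}` maps `ℬ(D)` into `H^∞_μ(D)`, and the
resulting linear operator between these normed spaces is compact. -/
def IsCompactWeightedComp (μ : Weight D) (ψ : HolFun D) (φ : HolSelfMap D) : Prop :=
  ∃ T : BlochSpace D →ₗ[ℂ] WeightedHinf μ,
    (∀ f : BlochSpace D, (T f : HolFun D) = weightedComp ψ φ (f : HolFun D)) ∧
    IsCompactOperator T

end Operator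

end BlochWCO

end

/-! The closed unit ball of the Bloch space is compact for locally uniform convergence. By
`exists_subseq_tendstoLocallyUniformlyOn`, a sequence of norm at most `C` has a locally uniformly
convergent subsequence whose limit again has norm at most `C`. If the operator is compact, the
images of a bounded null sequence lie in a compact set. Norm convergence implies pointwise
convergence, so every cluster point of the images is `0`, and the images tend to `0`. Conversely,
take a sequence of images of points of the unit ball, extract a locally uniform limit `g` of the
preimages, and apply the sequential condition to the differences with `g`. The images converge to
the image of `g`, so the image of the ball is sequentially compact.

The analytic content is equicontinuity. A Bloch function satisfies `|∇f(z)u| ≤ β_f H_z(u,u)^{1/2}`,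
so an upper bound for the Bergman metric on small balls makes Bloch functions locally Lipschitz
(`exists_lipschitz_blochSpace`), and connectedness of `D` carries bounds from the origin to every
point. The metric is locally bounded because its coefficients are continuous: `K(z,z)` is the
squared norm of the Riesz representative of evaluation at `z`, and evaluation is a holomorphic,
hence smooth, function of `z` with values in the dual of the Bergman space. -/

noncomputable section

namespace BlochWCO

/-! ### Holomorphic maps between normed spaces: Taylor remainders, limits, smoothness. -/

section HolomorphicMaps

open Metric

variable {E F : Type*} [NormedAddCommGroup E] [NormedSpace ℂ E] [NormedAddCommGroup F]
  [NormedSpace ℂ F]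

/-- Cauchy's estimate for the Fréchet derivative. -/
theorem norm_fderiv_le_of_bound {f : E → F} {c : E} {R M : ℝ} (hR : 0 < R)
    (hd : DifferentiableOn ℂ f (ball c R)) (hM : ∀ z ∈ ball c R, ‖f z‖ ≤ M) :
    ‖fderiv ℂ f c‖ ≤ 2 * M / R := by
  refine Complex.norm_fderiv_le_div_of_mapsTo_ball hd (fun z hz => ?_) hR
  rw [mem_closedBall, dist_eq_norm]
  linarith [norm_sub_le (f z) (f c), hM z hz, hM c (mem_ball_self hR)]

/-- First-order Taylor expansion of a bounded holomorphic map, with explicit remainder. -/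
theorem norm_sub_sub_fderiv_le {f : E → F} {c z : E} {R M : ℝ} (hR : 0 < R)
    (hd : DifferentiableOn ℂ f (ball c R)) (hM : ∀ z ∈ ball c R, ‖f z‖ ≤ M)
    (hz : z ∈ ball c R) :
    ‖f z - f c - fderiv ℂ f c (z - c)‖ ≤ 4 * M * (‖z - c‖ / R) ^ 2 := by
  have hdc : DifferentiableAt ℂ f c := hd.differentiableAt (ball_mem_nhds c hR)
  -- A Schwarz lemma of order two: subtracting the linear part leaves a map whose increment from `c`
  -- is `o(‖w - c‖)`. That increment is at most `M + M + 2M`, the last term coming from Cauchy's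
  -- estimate.
  have key := Complex.dist_le_mul_div_pow_of_mapsTo_ball_of_isLittleO (n := 1) (R₂ := 4 * M)
    (f := fun w => f w - fderiv ℂ f c (w - c)) (c := c) (R₁ := R) (z := z) ?_ ?_ ?_ hz
  · simp only [sub_self, map_zero, sub_zero, dist_eq_norm] at key
    rwa [sub_right_comm] at key
  · exact hd.sub (((fderiv ℂ f c).differentiable.comp
      (differentiable_id.sub_const c)).differentiableOn)
  · intro w hw
    simp only [sub_self, map_zero, sub_zero, mem_closedBall, dist_eq_norm]
    have hwR : ‖w - c‖ ≤ R := by simpa [dist_eq_norm] using (mem_ball.1 hw).le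
    have h1 : ‖fderiv ℂ f c (w - c)‖ ≤ 2 * M := by
      calc _ ≤ 2 * M / R * ‖w - c‖ := (fderiv ℂ f c).le_of_opNorm_le
              (norm_fderiv_le_of_bound hR hd hM) _
        _ ≤ 2 * M / R * R := by
            gcongr
            have := (norm_nonneg _).trans (hM c (mem_ball_self hR))
            positivity
        _ = 2 * M := by field_simp
    have h2 := norm_sub_le (f w - fderiv ℂ f c (w - c)) (f c)
    have h3 := norm_sub_le (f w) (fderiv ℂ f c (w - c))
    linarith [hM w hw, hM c (mem_ball_self hR)]
  · simp only [sub_self, map_zero, sub_zero, pow_one]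
    have := hdc.hasFDerivAt.isLittleO.norm_right
    refine this.congr_left fun w => ?_
    abel

/-- A map with a quadratic Taylor remainder is differentiable. -/
theorem hasFDerivAt_of_norm_sub_le {f : E → F} {c : E} {R C : ℝ} (hR : 0 < R) {L : E →L[ℂ] F}
    (h : ∀ z ∈ ball c R, ‖f z - f c - L (z - c)‖ ≤ C * ‖z - c‖ ^ 2) : HasFDerivAt f L c := by
  rw [hasFDerivAt_iff_isLittleO]
  have h1 : (fun z => f z - f c - L (z - c)) =O[𝓝 c] fun z => ‖z - c‖ ^ 2 := by
    refine Asymptotics.IsBigO.of_bound C ?_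
    filter_upwards [ball_mem_nhds c hR] with z hz
    rw [Real.norm_of_nonneg (by positivity)]
    exact h z hz
  have h2 : (fun z : E => ‖z - c‖ ^ 2) =o[𝓝 c] fun z => z - c := by
    have : Tendsto (fun z : E => z - c) (𝓝 c) (𝓝 0) := by
      simpa using (continuous_id.sub continuous_const).tendsto (x := c) (f := fun z : E => z - c)
    exact (Asymptotics.isLittleO_norm_pow_id one_lt_two).comp_tendsto this
  exact h1.trans_isLittleO h2

/-- The limit of a uniformly convergent, bounded sequence of holomorphic maps on a ball is
differentiable at the centre, and the derivatives at the centre converge. -/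
theorem exists_hasFDerivAt_of_tendstoUniformlyOn [CompleteSpace F] {f : ℕ → E → F} {g : E → F}
    {c : E} {R M : ℝ} (hR : 0 < R) (hd : ∀ k, DifferentiableOn ℂ (f k) (ball c R))
    (hM : ∀ k, ∀ z ∈ ball c R, ‖f k z‖ ≤ M) (hg : TendstoUniformlyOn f g atTop (ball c R)) :
    ∃ L : E →L[ℂ] F, Tendsto (fun k => fderiv ℂ (f k) c) atTop (𝓝 L) ∧ HasFDerivAt g L c := by
  have hcauchy : CauchySeq fun k => fderiv ℂ (f k) c := by
    -- Cauchy's estimate, applied to `f m - f k`, turns uniform closeness of the maps into closeness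
    -- of the derivatives.
    rw [Metric.cauchySeq_iff]
    intro ε hε
    obtain ⟨N, hN⟩ := Metric.uniformCauchySeqOn_iff.1 hg.uniformCauchySeqOn (ε * R / 4)
      (by positivity)
    refine ⟨N, fun m hm k hk => ?_⟩
    have hmem := ball_mem_nhds c hR
    have h1 : fderiv ℂ (fun z => f m z - f k z) c = fderiv ℂ (f m) c - fderiv ℂ (f k) c :=
      fderiv_fun_sub ((hd m).differentiableAt hmem) ((hd k).differentiableAt hmem)
    rw [dist_eq_norm, ← h1]
    calc _ ≤ 2 * (ε * R / 4) / R := norm_fderiv_le_of_bound hR ((hd m).sub (hd k)) fun z hz => by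
            rw [Pi.sub_apply, ← dist_eq_norm]; exact (hN m hm k hk z hz).le
      _ = ε / 2 := by field_simp; norm_num
      _ < ε := half_lt_self hε
  obtain ⟨L, hL⟩ := cauchySeq_tendsto_of_complete hcauchy
  refine ⟨L, hL, hasFDerivAt_of_norm_sub_le (C := 4 * M / R ^ 2) hR fun z hz => ?_⟩
  have hlim : Tendsto (fun k => ‖f k z - f k c - fderiv ℂ (f k) c (z - c)‖) atTop
      (𝓝 ‖g z - g c - L (z - c)‖) := by
    refine (((hg.tendsto_at hz).sub (hg.tendsto_at (mem_ball_self hR))).sub ?_).norm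
    exact ((ContinuousLinearMap.apply ℂ F (z - c)).continuous.tendsto L).comp hL
  -- The quadratic remainder bound does not depend on `k`, so it survives in the limit.
  refine le_of_tendsto' hlim fun k => (norm_sub_sub_fderiv_le hR (hd k) (hM k) hz).trans_eq ?_
  rw [div_pow]; ring

/-- Directional derivatives of holomorphic maps are holomorphic. -/
theorem differentiableAt_fderiv_apply [CompleteSpace F] {f : E → F} {U : Set E} (hU : IsOpen U)
    (hf : DifferentiableOn ℂ f U) {c : E} (hc : c ∈ U) (u : E) :
    DifferentiableAt ℂ (fun z => fderiv ℂ f z u) c := by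
  obtain ⟨R, hR, M, hRU, hM⟩ : ∃ R > 0, ∃ M, ball c (3 * R) ⊆ U ∧
      ∀ z ∈ ball c (3 * R), ‖f z‖ ≤ M := by
    have h1 : ∀ᶠ z in 𝓝 c, ‖f z‖ < ‖f c‖ + 1 :=
      (hf.continuousOn.continuousAt (hU.mem_nhds hc)).norm.eventually_lt_const (lt_add_one _)
    obtain ⟨r, hr, h⟩ := Metric.eventually_nhds_iff_ball.1 (h1.and (hU.mem_nhds hc))
    refine ⟨r / 3, by positivity, ‖f c‖ + 1, fun z hz => (h z ?_).2, fun z hz => (h z ?_).1.le⟩ <;>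
    · convert hz using 2; ring
  have hM0 : 0 ≤ M := (norm_nonneg _).trans (hM c (mem_ball_self (by positivity)))
  have hsub : ∀ z ∈ ball c R, ball z R ⊆ ball c (3 * R) := fun z hz w hw => by
    rw [mem_ball] at *
    linarith [dist_triangle w z c]
  -- Shifting the steps by `N` makes each displacement `t k • u` shorter than `R`.
  obtain ⟨N, hN⟩ := exists_nat_gt (‖u‖ / R)
  set t : ℕ → ℝ := fun k => 1 / ((k : ℝ) + N + 1) with ht
  have htpos : ∀ k, 0 < t k := fun k => by positivity
  have ht1 : ∀ k, t k ≤ 1 := fun k => by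
    rw [ht]; exact (div_le_one (by positivity)).2 
      (by linarith [k.cast_nonneg (α := ℝ), N.cast_nonneg (α := ℝ)])
  have htu : ∀ k, ‖(t k : ℂ) • u‖ < R := fun k => by
    rw [norm_smul, Complex.norm_real, Real.norm_of_nonneg (htpos k).le, ht]
    rw [div_lt_iff₀ hR] at hN
    simp only [one_div]
    rw [inv_mul_lt_iff₀ (by positivity)]
    nlinarith [k.cast_nonneg (α := ℝ)]
  have hmem : ∀ k, ∀ z ∈ ball c R, z + (t k : ℂ) • u ∈ ball z R := fun k z hz => by
    simpa [mem_ball, dist_eq_norm] using htu k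
  -- The Taylor remainder divided by `t k` is `O(t k)` uniformly in `z`: the directional derivative
  -- is a uniform limit of holomorphic difference quotients.
  have hquot : ∀ k, ∀ z ∈ ball c R,
      ‖(t k : ℂ)⁻¹ • (f (z + (t k : ℂ) • u) - f z) - fderiv ℂ f z u‖
        ≤ 4 * M * (‖u‖ / R) ^ 2 * t k := by
    intro k z hz
    have h1 := norm_sub_sub_fderiv_le hR (hf.mono ((hsub z hz).trans hRU))
      (fun w hw => hM w (hsub z hz hw)) (hmem k z hz)
    have h2 : (t k : ℂ) ≠ 0 := by exact_mod_cast (htpos k).ne'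
    have h3 : (t k : ℂ)⁻¹ • (f (z + (t k : ℂ) • u) - f z) - fderiv ℂ f z u
        = (t k : ℂ)⁻¹ • (f (z + (t k : ℂ) • u) - f z
            - fderiv ℂ f z (z + (t k : ℂ) • u - z)) := by
      rw [add_sub_cancel_left, map_smul, smul_sub _ (_ - _), smul_smul, inv_mul_cancel₀ h2, one_smul]
    rw [add_sub_cancel_left, norm_smul ((t k : ℂ)) u, Complex.norm_real,
      Real.norm_of_nonneg (htpos k).le] at h1
    rw [h3, norm_smul, norm_inv, Complex.norm_real, Real.norm_of_nonneg (htpos k).le,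
      inv_mul_le_iff₀ (htpos k)]
    rw [add_sub_cancel_left]
    refine h1.trans_eq ?_
    ring
  have httend : Tendsto t atTop (𝓝 0) := by
    have := (tendsto_one_div_add_atTop_nhds_zero_nat (𝕜 := ℝ)).comp (tendsto_add_atTop_nat N)
    refine this.congr fun k => ?_
    simp [ht]
  have hderiv : ∀ z ∈ ball c R, ‖fderiv ℂ f z u‖ ≤ 2 * M / R * ‖u‖ := fun z hz =>
    (fderiv ℂ f z).le_of_opNorm_le (norm_fderiv_le_of_bound hR
      (hf.mono ((hsub z hz).trans hRU)) fun w hw => hM w (hsub z hz hw)) u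
  refine (exists_hasFDerivAt_of_tendstoUniformlyOn (c := c) (R := R)
    (f := fun k z => (t k : ℂ)⁻¹ • (f (z + (t k : ℂ) • u) - f z))
    (g := fun z => fderiv ℂ f z u) (M := 4 * M * (‖u‖ / R) ^ 2 + 2 * M / R * ‖u‖) hR
    ?_ ?_ ?_).elim fun L hL => hL.2.differentiableAt
  · intro k
    refine DifferentiableOn.const_smul (DifferentiableOn.sub ?_ (hf.mono ?_)) _
    · exact hf.comp (differentiable_id.add_const _).differentiableOn
        fun z hz => hRU (hsub z hz (hmem k z hz))
    · exact (ball_subset_ball (by linarith)).trans hRU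
  · intro k z hz
    have h1 := hquot k z hz
    have h2 : 4 * M * (‖u‖ / R) ^ 2 * t k ≤ 4 * M * (‖u‖ / R) ^ 2 :=
      mul_le_of_le_one_right (by positivity) (ht1 k)
    have h3 := norm_le_norm_sub_add ((t k : ℂ)⁻¹ • (f (z + (t k : ℂ) • u) - f z)) (fderiv ℂ f z u)
    linarith [hderiv z hz]
  · rw [Metric.tendstoUniformlyOn_iff]
    intro ε hε
    have : Tendsto (fun k => 4 * M * (‖u‖ / R) ^ 2 * t k) atTop (𝓝 0) := by
      simpa using httend.const_mul (4 * M * (‖u‖ / R) ^ 2)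
    filter_upwards [this.eventually_lt_const hε] with k hk z hz
    rw [dist_comm, dist_eq_norm]
    exact (hquot k z hz).trans_lt hk

/-- Holomorphic maps on an open subset of a finite-dimensional space are smooth. -/
theorem contDiffOn_of_differentiableOn [FiniteDimensional ℂ E] [CompleteSpace F] {U : Set E}
    (hU : IsOpen U) (m : ℕ) {f : E → F} (hf : DifferentiableOn ℂ f U) : ContDiffOn ℂ m f U := by
  induction m generalizing f with
  | zero => exact contDiffOn_zero.2 hf.continuousOn
  | succ m ih =>
    push_cast
    rw [contDiffOn_succ_iff_fderiv_apply hU.uniqueDiffOn]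
    refine ⟨hf, by simp, fun u => ?_⟩
    refine (ih (f := fun z => fderiv ℂ f z u)
      fun z hz => (differentiableAt_fderiv_apply hU hf hz u).differentiableWithinAt).congr ?_
    intro z hz
    rw [fderivWithin_of_isOpen hU hz]

end HolomorphicMaps

/-! ### The mean value property on polydiscs (balls of the sup norm). -/

section MeanValue

open Metric

variable {n : ℕ}

theorem measurePreserving_circle_smul (a : Circle) :
    MeasurePreserving (fun w : Fin n → ℂ => (a : ℂ) • w) :=
  volume_preserving_pi fun _ => (rotation a).measurePreserving

/-- The mean value property of holomorphic functions on closed polydiscs. -/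
theorem setIntegral_closedBall_eq {f : (Fin n → ℂ) → ℂ} {U : Set (Fin n → ℂ)}
    (hf : DifferentiableOn ℂ f U) {z : Fin n → ℂ} {r : ℝ} (hr : closedBall z r ⊆ U) :
    ∫ w in closedBall z r, f w = volume.real (closedBall z r) • f z := by
  set B : Set (Fin n → ℂ) := closedBall 0 r
  have hmem : ∀ w ∈ B, ∀ a : ℂ, ‖a‖ ≤ 1 → z + a • w ∈ U := fun w hw a ha => hr <| by
    rw [mem_closedBall_iff_norm, add_sub_cancel_left, norm_smul]
    rw [mem_closedBall_zero_iff] at hw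
    exact (mul_le_of_le_one_left (norm_nonneg _) ha).trans hw
  have htrans : ∀ g : (Fin n → ℂ) → ℂ, ∫ w in closedBall z r, g w = ∫ w in B, g (z + w) := by
    intro g
    rw [← (measurePreserving_add_left volume z).setIntegral_preimage_emb
      (measurableEmbedding_addLeft z), preimage_add_closedBall, sub_self]
  have hvol : volume.real (closedBall z r) = volume.real B := by
    simp only [measureReal_def, B, Measure.addHaar_closedBall_center]
  -- Rotating all coordinates by the same angle preserves `B` and the volume. Averaging over the
  -- angle and exchanging integrals reduces the claim to the one-variable mean value property on the
  -- slices `t ↦ f (z + t • w)`.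
  have hrot : ∀ θ : ℝ, ∫ w in B, f (z + circleMap 0 1 θ • w) = ∫ w in B, f (z + w) := by
    intro θ
    have hθ : circleMap 0 1 θ = (Circle.exp θ : ℂ) := by simp [circleMap]
    have hpre : (fun w : Fin n → ℂ => (Circle.exp θ : ℂ) • w) ⁻¹' B = B := by
      ext w
      simp [B, norm_smul]
    rw [hθ]
    have := (measurePreserving_circle_smul (n := n) (Circle.exp θ)).setIntegral_preimage_emb
      (measurableEmbedding_const_smul₀ (Circle.coe_ne_zero _)) (fun w => f (z + w)) B
    rwa [hpre] at this
  have hmean : ∀ w ∈ B, ∫ θ in (0 : ℝ)..2 * Real.pi, f (z + circleMap 0 1 θ • w)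
      = (2 * Real.pi) • f z := by
    intro w hw
    have hd : DifferentiableOn ℂ (fun t : ℂ => f (z + t • w)) (closedBall 0 1) :=
      hf.comp (by fun_prop) fun t ht => hmem w hw t (by simpa using ht)
    have h1 : DiffContOnCl ℂ (fun t : ℂ => f (z + t • w)) (ball 0 |1|) := by
      rw [abs_one]
      exact (hd.mono (by rw [closure_ball _ one_ne_zero])).diffContOnCl
    have h2 := h1.circleAverage
    rw [Real.circleAverage_def, zero_smul, add_zero] at h2
    rw [← h2, smul_smul, mul_inv_cancel₀ (by positivity), one_smul]
  have hint : Integrable (Function.uncurry fun (θ : ℝ) (w : Fin n → ℂ) =>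
      f (z + circleMap 0 1 θ • w))
      ((volume.restrict (Set.Ioc 0 (2 * Real.pi))).prod (volume.restrict B)) := by
    rw [Measure.prod_restrict]
    have hc : ContinuousOn (Function.uncurry fun (θ : ℝ) (w : Fin n → ℂ) =>
        f (z + circleMap 0 1 θ • w)) (Set.Icc 0 (2 * Real.pi) ×ˢ B) := by
      refine hf.continuousOn.comp (f := fun p : ℝ × (Fin n → ℂ) => z + circleMap 0 1 p.1 • p.2)
        (Continuous.continuousOn ?_) fun p hp => hmem p.2 hp.2 _ (by simp)
      exact continuous_const.add (((continuous_circleMap 0 1).comp continuous_fst).smul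
        continuous_snd)
    exact (hc.integrableOn_compact (isCompact_Icc.prod (isCompact_closedBall 0 r))).mono_set
      (Set.prod_mono Set.Ioc_subset_Icc_self subset_rfl)
  have hswap := integral_integral_swap hint
  simp only [hrot, ← intervalIntegral.integral_of_le Real.two_pi_pos.le] at hswap
  rw [setIntegral_congr_fun measurableSet_closedBall hmean] at hswap
  simp only [intervalIntegral.integral_const, sub_zero, setIntegral_const] at hswap
  rw [smul_comm] at hswap
  rw [htrans, hvol]
  exact smul_right_injective ℂ Real.two_pi_pos.ne' hswap

end MeanValue

/-! ### The Bergman space inside `L²` and its point evaluations. -/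

section BergmanSpace

open Metric

variable {n : ℕ} (D : BoundedHomogeneousDomain n)

/-- Lebesgue measure on the domain. -/
abbrev domainMeasure : Measure (Fin n → ℂ) := volume.restrict D.carrier

instance : IsFiniteMeasure (domainMeasure D) :=
  ⟨by rw [Measure.restrict_apply_univ]; exact D.isBounded.measure_lt_top⟩

/-- The Bergman space as a linear subspace of the holomorphic functions. -/
def bergmanSubmodule : Submodule ℂ (HolFun D) where
  carrier := BergmanSpace D
  add_mem' hf hg := MemLp.add hf hg
  zero_mem' := MemLp.zero
  smul_mem' c _ hf := MemLp.const_smul hf c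

/-- The inclusion of the Bergman space into `L²`. -/
def bergmanToLp : bergmanSubmodule D →ₗ[ℂ] Lp ℂ 2 (domainMeasure D) where
  toFun f := MemLp.toLp (⇑f.1) f.2
  map_add' f g := MemLp.toLp_add f.2 g.2
  map_smul' c f := MemLp.toLp_const_smul c f.2

theorem bergmanToLp_coe_ae (f : bergmanSubmodule D) :
    (bergmanToLp D f : (Fin n → ℂ) → ℂ) =ᵐ[domainMeasure D] ⇑f.1 :=
  MemLp.coeFn_toLp f.2

/-- Continuous functions that agree almost everywhere on an open set agree on all of it. -/
theorem bergmanToLp_injective : Function.Injective (bergmanToLp D) := by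
  intro f g h
  refine Subtype.ext (HolFun.ext_on fun z hz => ?_)
  exact Measure.eqOn_open_of_ae_eq (μ := volume)
    ((bergmanToLp_coe_ae D f).symm.trans (h ▸ bergmanToLp_coe_ae D g)) D.isOpen
    f.1.differentiableOn.continuousOn g.1.differentiableOn.continuousOn hz

/-- Point evaluations on the Bergman space are bounded, locally uniformly in the point. -/
theorem exists_norm_eval_le {z : Fin n → ℂ} (hz : z ∈ D.carrier) :
    ∃ R > 0, ∃ C, 0 ≤ C ∧ ball z R ⊆ D.carrier ∧
      ∀ f : bergmanSubmodule D, ∀ w ∈ ball z R, ‖f.1 w‖ ≤ C * ‖bergmanToLp D f‖ := by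
  obtain ⟨ε, hε, hεD⟩ := Metric.isOpen_iff.1 D.isOpen z hz
  have hball : ∀ w ∈ ball z (ε / 2), closedBall w (ε / 3) ⊆ D.carrier := fun w hw v hv => hεD <| by
    rw [mem_ball] at *
    rw [mem_closedBall] at hv
    linarith [dist_triangle v w z]
  set V : ℝ := volume.real (closedBall (0 : Fin n → ℂ) (ε / 3)) with hV
  have hVpos : 0 < V := by
    rw [hV, measureReal_def]
    exact ENNReal.toReal_pos (measure_closedBall_pos _ _ (by positivity)).ne'
      measure_closedBall_lt_top.ne
  -- The constant comes from Cauchy–Schwarz: `V • f w` is the inner product of `f` with the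
  -- indicator of a polydisc about `w`, whose `L²` norm is at most that of `1` on `D`. Translation
  -- invariance makes `V` independent of `w`.
  refine ⟨ε / 2, by positivity, V⁻¹ * (domainMeasure D).real Set.univ ^ (1 / (2 : ℝ≥0∞).toReal),
    by positivity, (ball_subset_ball (by linarith)).trans hεD, fun f w hw => ?_⟩
  set B := closedBall w (ε / 3)
  have hsub : B ⊆ D.carrier := hball w hw
  have hBV : volume.real B = V := by
    simp only [hV, measureReal_def, B, Measure.addHaar_closedBall_center]
  have hres : (domainMeasure D).restrict B = volume.restrict B :=
    Measure.restrict_restrict_of_subset hsub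
  have h1 := L2.inner_indicatorConstLp_one (𝕜 := ℂ) (measurableSet_closedBall (x := w) (ε := ε / 3))
    (measure_ne_top (domainMeasure D) _) (bergmanToLp D f)
  have h2 : ∫ x in B, bergmanToLp D f x ∂(domainMeasure D) = V • f.1 w := by
    rw [integral_congr_ae (ae_restrict_of_ae (bergmanToLp_coe_ae D f)), hres,
      setIntegral_closedBall_eq f.1.differentiableOn hsub, hBV]
  have h3 : ‖V • f.1 w‖ ≤ (domainMeasure D).real Set.univ ^ (1 / (2 : ℝ≥0∞).toReal)
      * ‖bergmanToLp D f‖ := by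
    rw [← h2, ← h1]
    refine (norm_inner_le_norm _ _).trans ?_
    gcongr
    refine norm_indicatorConstLp_le.trans ?_
    rw [norm_one, one_mul]
    gcongr
    · exact measure_ne_top _ _
    · exact Set.subset_univ _
  rw [norm_smul, Real.norm_of_nonneg hVpos.le] at h3
  rw [mul_assoc, le_inv_mul_iff₀ hVpos]
  exact h3

end BergmanSpace

/-! ### The Bergman kernel by Riesz representation, and continuity of the metric coefficients. -/

section BergmanKernel

open Metric

variable {n : ℕ} (D : BoundedHomogeneousDomain n)

/-- The Bergman space as a subspace of `L²`. -/
abbrev bergmanRange : Submodule ℂ (Lp ℂ 2 (domainMeasure D)) := (bergmanToLp D).range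

/-- The element of `HolFun D` that agrees on `D` with a given holomorphic function. -/
def HolFun.ofDifferentiableOn (f : (Fin n → ℂ) → ℂ) (hf : DifferentiableOn ℂ f D.carrier) :
    HolFun D where
  toFun := D.carrier.indicator f
  differentiableOn := hf.congr fun _ hz => Set.indicator_of_mem hz f
  eq_zero _ hz := Set.indicator_of_notMem hz f

/-- `L²` convergence forces locally uniform convergence through the evaluation bounds, so the
pointwise limit is holomorphic. Closedness gives completeness, which Riesz representation needs. -/
theorem isClosed_bergmanRange : IsClosed (bergmanRange D : Set (Lp ℂ 2 (domainMeasure D))) := by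
  refine IsSeqClosed.isClosed fun g h hg hlim => ?_
  choose f hf using hg
  have hcauchy : CauchySeq g := hlim.cauchySeq
  obtain ⟨M, hM⟩ : ∃ M, ∀ k, ‖g k‖ ≤ M := by
    obtain ⟨M, hM⟩ := (isBounded_range_of_tendsto g hlim).exists_norm_le
    exact ⟨M, fun k => hM _ ⟨k, rfl⟩⟩
  have hpt : ∀ z, ∃ l, Tendsto (fun k => (f k).1 z) atTop (𝓝 l) := by
    intro z
    by_cases hz : z ∈ D.carrier
    · obtain ⟨R, hR, C, hC, -, hbd⟩ := exists_norm_eval_le D hz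
      refine cauchySeq_tendsto_of_complete (Metric.cauchySeq_iff.2 fun ε hε => ?_)
      obtain ⟨N, hN⟩ := Metric.cauchySeq_iff.1 hcauchy (ε / (C + 1)) (by positivity)
      refine ⟨N, fun m hm k hk => ?_⟩
      have h1 := hbd (f m - f k) z (mem_ball_self hR)
      have h2 := hN m hm k hk
      rw [map_sub, hf, hf, ← dist_eq_norm] at h1
      rw [lt_div_iff₀ (by positivity)] at h2
      have h3 : dist ((f m).1 z) ((f k).1 z) ≤ C * dist (g m) (g k) := by
        rw [dist_eq_norm]; exact h1
      nlinarith [dist_nonneg (x := g m) (y := g k)]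
    · exact ⟨0, by simp only [HolFun.eq_zero _ z hz]; exact tendsto_const_nhds⟩
  choose F hF using hpt
  have hd : DifferentiableOn ℂ F D.carrier := by
    intro z hz
    obtain ⟨R, hR, C, hC, hRD, hbd⟩ := exists_norm_eval_le D hz
    have hunif : TendstoUniformlyOn (fun k w => (f k).1 w) F atTop (ball z R) := by
      refine UniformCauchySeqOn.tendstoUniformlyOn_of_tendsto ?_ fun w _ => hF w
      refine Metric.uniformCauchySeqOn_iff.2 fun ε hε => ?_
      obtain ⟨N, hN⟩ := Metric.cauchySeq_iff.1 hcauchy (ε / (C + 1)) (by positivity)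
      refine ⟨N, fun m hm k hk w hw => ?_⟩
      have h1 := hbd (f m - f k) w hw
      have h2 := hN m hm k hk
      rw [map_sub, hf, hf, ← dist_eq_norm] at h1
      rw [lt_div_iff₀ (by positivity)] at h2
      have h3 : dist ((f m).1 w) ((f k).1 w) ≤ C * dist (g m) (g k) := by
        rw [dist_eq_norm]; exact h1
      nlinarith [dist_nonneg (x := g m) (y := g k)]
    obtain ⟨L, -, hL⟩ := exists_hasFDerivAt_of_tendstoUniformlyOn (M := C * M) hR
      (fun k => (f k).1.differentiableOn.mono hRD)
      (fun k w hw => (hbd (f k) w hw).trans (by rw [hf]; gcongr; exact hM k)) hunif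
    exact hL.differentiableAt.differentiableWithinAt
  -- A subsequence converging almost everywhere identifies the `L²` limit `h` with the pointwise
  -- limit `F`.
  obtain ⟨φ, hφ, hae⟩ := (tendstoInMeasure_of_tendsto_Lp hlim).exists_seq_tendsto_ae
  have hFh : (h : (Fin n → ℂ) → ℂ) =ᵐ[domainMeasure D]
      ⇑(HolFun.ofDifferentiableOn D F hd) := by
    have hall : ∀ᵐ x ∂(domainMeasure D), ∀ k, (g k : (Fin n → ℂ) → ℂ) x = (f k).1 x :=
      ae_all_iff.2 fun k => by
        have := bergmanToLp_coe_ae D (f k)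
        rwa [hf] at this
    filter_upwards [hae, hall, ae_restrict_mem D.isOpen.measurableSet] with x hx hx' hxD
    have h1 : (HolFun.ofDifferentiableOn D F hd) x = F x := Set.indicator_of_mem hxD F
    rw [h1]
    refine tendsto_nhds_unique hx (((hF x).comp hφ.tendsto_atTop).congr fun k => ?_)
    exact (hx' _).symm
  refine ⟨⟨HolFun.ofDifferentiableOn D F hd, (memLp_congr_ae hFh).1 (Lp.memLp h)⟩, ?_⟩
  exact Lp.ext ((bergmanToLp_coe_ae D _).trans hFh.symm)

instance : CompleteSpace (bergmanRange D) :=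
  (isClosed_bergmanRange D).completeSpace_coe

/-- The Bergman space is linearly isomorphic to its image in `L²`. -/
def bergmanEquiv : bergmanSubmodule D ≃ₗ[ℂ] bergmanRange D :=
  LinearEquiv.ofInjective (bergmanToLp D) (bergmanToLp_injective D)

theorem bergmanToLp_bergmanEquiv_symm (h : bergmanRange D) :
    bergmanToLp D ((bergmanEquiv D).symm h) = h :=
  congrArg Subtype.val ((bergmanEquiv D).apply_symm_apply h)

/-- The linear functional `f ↦ f(z)` on the Bergman space. -/
def evalLinear (z : Fin n → ℂ) : bergmanRange D →ₗ[ℂ] ℂ where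
  toFun h := ((bergmanEquiv D).symm h).1 z
  map_add' h k := by rw [map_add]; rfl
  map_smul' c h := by rw [map_smul]; rfl

/-- The continuous linear functional `f ↦ f(z)` on the Bergman space. -/
def evalCLM (z : Fin n → ℂ) : bergmanRange D →L[ℂ] ℂ :=
  (evalLinear D z).mkContinuousOfExistsBound <| by
    by_cases hz : z ∈ D.carrier
    · obtain ⟨R, hR, C, -, -, hbd⟩ := exists_norm_eval_le D hz
      refine ⟨C, fun h => (hbd _ z (mem_ball_self hR)).trans_eq ?_⟩
      rw [bergmanToLp_bergmanEquiv_symm]; rfl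
    · exact ⟨0, fun h => by
        rw [zero_mul]
        exact (norm_eq_zero.2 (HolFun.eq_zero _ z hz)).le⟩

theorem evalCLM_apply (z : Fin n → ℂ) (h : bergmanRange D) :
    evalCLM D z h = ((bergmanEquiv D).symm h).1 z := rfl

/-- Point evaluation depends holomorphically on the point. -/
theorem differentiableOn_evalCLM : DifferentiableOn ℂ (evalCLM D) D.carrier := by
  intro z hz
  obtain ⟨R, hR, C, hC, hRD, hbd⟩ := exists_norm_eval_le D hz
  have hbd' : ∀ h : bergmanRange D, ∀ w ∈ ball z R, ‖((bergmanEquiv D).symm h).1 w‖ ≤ C * ‖h‖ := by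
    intro h w hw
    refine (hbd _ w hw).trans_eq ?_
    rw [bergmanToLp_bergmanEquiv_symm]; rfl
  have hdiff : ∀ h : bergmanRange D, DifferentiableOn ℂ ((bergmanEquiv D).symm h).1 (ball z R) :=
    fun h => ((bergmanEquiv D).symm h).1.differentiableOn.mono hRD
  -- The candidate derivative sends `u` to `h ↦ ∂_u h(z)`. The scalar Taylor remainder is bounded by
  -- a multiple of `‖h‖`, so the expansion holds in operator norm.
  let L : (Fin n → ℂ) →L[ℂ] bergmanRange D →L[ℂ] ℂ :=
    LinearMap.mkContinuous₂ (LinearMap.mk₂ ℂ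
      (fun u h => fderiv ℂ ((bergmanEquiv D).symm h).1 z u)
      (fun u v h => map_add _ u v) (fun c u h => map_smul _ c u)
      (fun u h k => by
        have : (((bergmanEquiv D).symm (h + k)).1 : (Fin n → ℂ) → ℂ)
            = ⇑((bergmanEquiv D).symm h).1 + ⇑((bergmanEquiv D).symm k).1 := by
          rw [map_add]; rfl
        rw [this, fderiv_add (HolFun.differentiableAt _ hz) (HolFun.differentiableAt _ hz)]
        rfl)
      (fun c u h => by
        have : (((bergmanEquiv D).symm (c • h)).1 : (Fin n → ℂ) → ℂ)
            = c • ⇑((bergmanEquiv D).symm h).1 := by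
          rw [map_smul]; rfl
        rw [this, fderiv_const_smul (HolFun.differentiableAt _ hz)]
        rfl))
      (2 * C / R) fun u h => by
        refine ((fderiv ℂ ((bergmanEquiv D).symm h).1 z).le_of_opNorm_le
          (norm_fderiv_le_of_bound hR (hdiff h) (hbd' h)) u).trans_eq ?_
        ring
  refine (hasFDerivAt_of_norm_sub_le (E := Fin n → ℂ) (F := bergmanRange D →L[ℂ] ℂ) (L := L) (C := 4 * C / R ^ 2) hR
    fun w hw => ?_).differentiableAt.differentiableWithinAt
  refine ContinuousLinearMap.opNorm_le_bound _ (by positivity) fun h => ?_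
  refine (norm_sub_sub_fderiv_le hR (hdiff h) (hbd' h) hw).trans_eq ?_
  rw [div_pow]; ring

/-- The Riesz representative of evaluation at `z`. -/
def kernelVec (z : Fin n → ℂ) : bergmanRange D :=
  (InnerProductSpace.toDual ℂ (bergmanRange D)).symm (evalCLM D z)

/-- The Riesz isomorphism is conjugate-linear, so smoothness passes through it only over `ℝ`. -/
theorem contDiffOn_kernelVec : ContDiffOn ℝ 2 (kernelVec D) D.carrier := by
  have h1 : ContDiffOn ℝ 2 (evalCLM D) D.carrier :=
    (contDiffOn_of_differentiableOn D.isOpen 2 (differentiableOn_evalCLM D)).restrict_scalars ℝ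
  let Λ : StrongDual ℂ (bergmanRange D) →L[ℝ] bergmanRange D :=
    { toFun := (InnerProductSpace.toDual ℂ (bergmanRange D)).symm
      map_add' := map_add _
      map_smul' := fun c x => by
        have := map_smulₛₗ (InnerProductSpace.toDual ℂ (bergmanRange D)).symm (c : ℂ) x
        simpa using! this
      cont := (InnerProductSpace.toDual ℂ (bergmanRange D)).symm.continuous }
  exact Λ.contDiff.comp_contDiffOn h1

theorem inner_bergmanToLp (f k : bergmanSubmodule D) :
    inner ℂ (bergmanToLp D k) (bergmanToLp D f) = ∫ ζ in D.carrier, f.1 ζ * conj (k.1 ζ) := by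
  rw [L2.inner_def]
  refine integral_congr_ae ?_
  filter_upwards [bergmanToLp_coe_ae D f, bergmanToLp_coe_ae D k] with ζ h1 h2
  rw [h1, h2]
  rfl

theorem representsEval_kernelVec (z : Fin n → ℂ) :
    RepresentsEval D z ((bergmanEquiv D).symm (kernelVec D z)).1 := by
  refine ⟨((bergmanEquiv D).symm (kernelVec D z)).2, fun f hf => ?_⟩
  have h1 := inner_bergmanToLp D ⟨f, hf⟩ ((bergmanEquiv D).symm (kernelVec D z))
  rw [← h1, bergmanToLp_bergmanEquiv_symm]
  have h2 : inner ℂ (kernelVec D z) (bergmanEquiv D ⟨f, hf⟩)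
      = evalCLM D z (bergmanEquiv D ⟨f, hf⟩) := InnerProductSpace.toDual_symm_apply
  rw [evalCLM_apply, LinearEquiv.symm_apply_apply] at h2
  exact h2.symm

/-- This uniqueness identifies the function that `Classical.epsilon` selects in `bergmanKernel`. -/
theorem RepresentsEval.eq_kernelVec {z : Fin n → ℂ} {k : HolFun D} (hk : RepresentsEval D z k) :
    k = ((bergmanEquiv D).symm (kernelVec D z)).1 := by
  have h : bergmanEquiv D ⟨k, hk.1⟩ = kernelVec D z := by
    refine ext_inner_right ℂ fun h => ?_
    rw [kernelVec, InnerProductSpace.toDual_symm_apply, evalCLM_apply,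
      hk.2 _ ((bergmanEquiv D).symm h).2, ← inner_bergmanToLp D _ ⟨k, hk.1⟩,
      bergmanToLp_bergmanEquiv_symm]
    rfl
  rw [← h, LinearEquiv.symm_apply_apply]

/-- The reproducing property is applied to the representative itself. -/
theorem bergmanKernel_self (z : Fin n → ℂ) :
    bergmanKernel D z z = ((‖kernelVec D z‖ ^ 2 : ℝ) : ℂ) := by
  have h1 : Classical.epsilon (RepresentsEval D z) = ((bergmanEquiv D).symm (kernelVec D z)).1 :=
    (Classical.epsilon_spec (p := RepresentsEval D z) ⟨_, representsEval_kernelVec D z⟩).eq_kernelVec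
  have h2 : inner ℂ (kernelVec D z) (kernelVec D z) = evalCLM D z (kernelVec D z) :=
    InnerProductSpace.toDual_symm_apply
  have h3 : inner ℂ (kernelVec D z) (kernelVec D z) = (‖kernelVec D z‖ : ℂ) ^ 2 :=
    inner_self_eq_norm_sq_to_K (𝕜 := ℂ) (kernelVec D z)
  rw [bergmanKernel, h1, ← evalCLM_apply, ← h2, h3]
  simp

/-- Since `D` has finite measure, the constant `1` lies in the Bergman space, and a zero
representative would evaluate it to `0`. -/
theorem kernelVec_ne_zero {z : Fin n → ℂ} (hz : z ∈ D.carrier) : kernelVec D z ≠ 0 := by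
  intro h0
  let f : HolFun D := HolFun.ofDifferentiableOn D (fun _ => 1) (differentiableOn_const 1)
  have hf : f ∈ BergmanSpace D := by
    refine (memLp_congr_ae ?_).1 (memLp_const (1 : ℂ))
    filter_upwards [ae_restrict_mem D.isOpen.measurableSet] with x hx
    exact (Set.indicator_of_mem hx (fun _ => (1 : ℂ))).symm
  have h1 := (representsEval_kernelVec D z).2 f hf
  have h2 : f z = 1 := Set.indicator_of_mem hz (fun _ => (1 : ℂ))
  rw [h2, h0, map_zero] at h1
  simp [HolFun.coe_zero] at h1

/-- The logarithm of the Bergman kernel on the diagonal is twice continuously differentiable. -/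
theorem contDiffOn_log_bergmanKernel :
    ContDiffOn ℝ 2 (fun w => ((Real.log (bergmanKernel D w w).re : ℝ) : ℂ)) D.carrier := by
  simp only [bergmanKernel_self, Complex.ofReal_re]
  refine Complex.ofRealCLM.contDiff.comp_contDiffOn (ContDiffOn.log ?_ fun z hz => ?_)
  · exact (contDiffOn_kernelVec D).norm_sq ℂ
  · exact pow_ne_zero 2 (norm_ne_zero_iff.2 (kernelVec_ne_zero D hz))

/-- The coefficients of the Bergman metric are continuous. -/
theorem continuousOn_bergmanCoeff (i j : Fin n) : ContinuousOn (bergmanCoeff D i j) D.carrier := by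
  have hderiv : ∀ (m : ℕ) (G : (Fin n → ℂ) → ℂ) (v : Fin n → ℂ), ContDiffOn ℝ (m + 1) G D.carrier →
      ContDiffOn ℝ m (fun z => fderiv ℝ G z v) D.carrier := fun m G v hG =>
    (hG.fderiv_of_isOpen D.isOpen le_rfl).clm_apply contDiffOn_const
  have h2 := contDiffOn_log_bergmanKernel D
  have h1 : ContDiffOn ℝ 1 (wirtingerBar j
      fun w => ((Real.log (bergmanKernel D w w).re : ℝ) : ℂ)) D.carrier := by
    have h := fun v => hderiv 1 _ v (by norm_num; exact h2)
    exact contDiffOn_const.mul ((h _).add (contDiffOn_const.mul (h _)))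
  have h := fun v => (hderiv 0 _ v (by norm_num; exact h1)).continuousOn
  exact continuousOn_const.mul ((h _).sub (continuousOn_const.mul (h _)))

end BergmanKernel

/-! ### Bloch functions: local bounds and compactness of balls. -/

section BlochEstimates

open Metric

variable {n : ℕ} {D : BoundedHomogeneousDomain n}

theorem norm_fderiv_le_blochBeta {f : HolFun D} (hf : blochBeta f ≠ ⊤) {z : Fin n → ℂ}
    (hz : z ∈ D.carrier) (u : Fin n → ℂ) :
    ‖fderiv ℂ f z u‖ ≤ (blochBeta f).toReal * Real.sqrt (bergmanMetric D z u u).re := by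
  by_cases hu : u = 0
  · rw [hu, map_zero, norm_zero]; positivity
  have h1 : ‖fderiv ℂ f z u‖ₑ / ENNReal.ofReal (Real.sqrt (bergmanMetric D z u u).re)
      ≤ blochBeta f :=
    le_trans (le_iSup₂_of_le u hu le_rfl) (le_iSup₂ (f := fun z _ => blochQ f z) z hz)
  -- A zero denominator is harmless: a nonzero numerator over `0` is `⊤`, which finiteness of `β_f`
  -- excludes.
  rw [ENNReal.div_le_iff_le_mul (Or.inr hf) (Or.inl ENNReal.ofReal_ne_top)] at h1
  have h2 := ENNReal.toReal_mono (ENNReal.mul_ne_top hf ENNReal.ofReal_ne_top) h1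
  rwa [toReal_enorm, ENNReal.toReal_mul, ENNReal.toReal_ofReal (Real.sqrt_nonneg _)] at h2

theorem blochBeta_le_of_norm_fderiv_le {f : HolFun D} {B : ℝ} (hB : 0 ≤ B)
    (h : ∀ z ∈ D.carrier, ∀ u,
      ‖fderiv ℂ f z u‖ ≤ B * Real.sqrt (bergmanMetric D z u u).re) :
    blochBeta f ≤ ENNReal.ofReal B := by
  refine iSup₂_le fun z hz => iSup₂_le fun u _ => ENNReal.div_le_of_le_mul ?_
  rw [← ENNReal.ofReal_mul hB, ← ofReal_norm]
  exact ENNReal.ofReal_le_ofReal (h z hz u)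

variable (D) in
/-- The Bergman metric is locally bounded by a multiple of the Euclidean metric. -/
theorem exists_sqrt_bergmanMetric_le {z : Fin n → ℂ} (hz : z ∈ D.carrier) :
    ∃ R > 0, ∃ C, 0 ≤ C ∧ ball z R ⊆ D.carrier ∧ ∀ w ∈ ball z R, ∀ u,
      Real.sqrt (bergmanMetric D w u u).re ≤ C * ‖u‖ := by
  have hc : ContinuousOn (fun w => ∑ i, ∑ j, ‖bergmanCoeff D i j w‖) D.carrier :=
    continuousOn_finsetSum _ fun i _ => continuousOn_finsetSum _ fun j _ =>
      (continuousOn_bergmanCoeff D i j).norm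
  set S : ℝ := ∑ i, ∑ j, ‖bergmanCoeff D i j z‖
  have h1 : ∀ᶠ w in 𝓝 z, ∑ i, ∑ j, ‖bergmanCoeff D i j w‖ < S + 1 :=
    (hc.continuousAt (D.isOpen.mem_nhds hz)).eventually_lt_const (lt_add_one S)
  obtain ⟨R, hR, h⟩ := Metric.eventually_nhds_iff_ball.1 (h1.and (D.isOpen.mem_nhds hz))
  refine ⟨R, hR, Real.sqrt (S + 1), Real.sqrt_nonneg _, fun w hw => (h w hw).2, fun w hw u => ?_⟩
  have h2 : (bergmanMetric D w u u).re ≤ (S + 1) * ‖u‖ ^ 2 := by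
    calc (bergmanMetric D w u u).re ≤ ‖bergmanMetric D w u u‖ := Complex.re_le_norm _
      _ ≤ ∑ i, ∑ j, ‖bergmanCoeff D i j w * u i * conj (u j)‖ :=
          (norm_sum_le _ _).trans (Finset.sum_le_sum fun i _ => norm_sum_le _ _)
      _ ≤ ∑ i, ∑ j, ‖bergmanCoeff D i j w‖ * ‖u‖ ^ 2 := by
          refine Finset.sum_le_sum fun i _ => Finset.sum_le_sum fun j _ => ?_
          rw [norm_mul, norm_mul, RCLike.norm_conj, mul_assoc, sq]
          gcongr
          · exact norm_le_pi_norm u i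
          · exact norm_le_pi_norm u j
      _ = (∑ i, ∑ j, ‖bergmanCoeff D i j w‖) * ‖u‖ ^ 2 := by
          simp only [Finset.sum_mul]
      _ ≤ (S + 1) * ‖u‖ ^ 2 := by
          gcongr
          exact (h w hw).1.le
  calc _ ≤ Real.sqrt ((S + 1) * ‖u‖ ^ 2) := Real.sqrt_le_sqrt h2
    _ = _ := by rw [Real.sqrt_mul' _ (sq_nonneg _), Real.sqrt_sq (norm_nonneg _)]

theorem blochBeta_toReal_le_norm (f : BlochSpace D) : (blochBeta f.1).toReal ≤ ‖f‖ := by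
  rw [bloch_norm_def]
  exact le_add_of_nonneg_left (norm_nonneg _)

variable (D) in
/-- Bloch functions are locally Lipschitz, uniformly on bounded subsets of the Bloch space. -/
theorem exists_lipschitz_blochSpace {z : Fin n → ℂ} (hz : z ∈ D.carrier) :
    ∃ R > 0, ∃ C, 0 ≤ C ∧ ball z R ⊆ D.carrier ∧ ∀ f : BlochSpace D, ∀ w ∈ ball z R,
      ∀ v ∈ ball z R, ‖f.1 v - f.1 w‖ ≤ C * ‖f‖ * ‖v - w‖ := by
  obtain ⟨R, hR, C, hC, hRD, h⟩ := exists_sqrt_bergmanMetric_le D hz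
  refine ⟨R, hR, C, hC, hRD, fun f w hw v hv => ?_⟩
  refine (convex_ball z R).norm_image_sub_le_of_norm_fderiv_le (𝕜 := ℂ)
    (fun x hx => f.1.differentiableAt (hRD hx)) (fun x hx => ?_) hw hv
  refine ContinuousLinearMap.opNorm_le_bound _ (by positivity) fun u => ?_
  calc _ ≤ (blochBeta f.1).toReal * Real.sqrt (bergmanMetric D x u u).re :=
        norm_fderiv_le_blochBeta f.2.ne (hRD hx) u
    _ ≤ ‖f‖ * (C * ‖u‖) := by
        gcongr
        · exact blochBeta_toReal_le_norm f
        · exact h x hx u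
    _ = C * ‖f‖ * ‖u‖ := by ring

variable (D) in
/-- Point evaluations on the Bloch space are bounded. -/
theorem exists_norm_apply_le_blochSpace {z : Fin n → ℂ} (hz : z ∈ D.carrier) :
    ∃ C, 0 ≤ C ∧ ∀ f : BlochSpace D, ‖f.1 z‖ ≤ C * ‖f‖ := by
  set S : Set (Fin n → ℂ) := {z | z ∈ D.carrier ∧ ∃ C, 0 ≤ C ∧ ∀ f : BlochSpace D,
    ‖f.1 z‖ ≤ C * ‖f‖}
  have hstep : ∀ x ∈ D.carrier, ∃ R > 0, ball x R ⊆ D.carrier ∧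
      ∀ w ∈ ball x R, ∀ v ∈ ball x R, w ∈ S → v ∈ S := by
    intro x hx
    obtain ⟨R, hR, C, hC, hRD, h⟩ := exists_lipschitz_blochSpace D hx
    refine ⟨R, hR, hRD, fun w hw v hv hwS => ⟨hRD hv, ?_⟩⟩
    obtain ⟨-, C', hC', h'⟩ := hwS
    refine ⟨C' + C * ‖v - w‖, by positivity, fun f => ?_⟩
    have h1 := norm_le_norm_add_norm_sub' (f.1 v) (f.1 w)
    have h2 := h f w hw v hv
    have h3 := h' f
    calc _ ≤ _ := h1
      _ ≤ C' * ‖f‖ + C * ‖f‖ * ‖v - w‖ := add_le_add h3 h2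
      _ = _ := by ring
  -- By `hstep`, `S` is open and relatively closed in `D`. It contains the origin, where the norm
  -- controls the value, so connectedness gives all of `D`.
  have hsub : D.carrier ⊆ S := by
    refine D.isConnected.isPreconnected.subset_of_closure_inter_subset ?_ ?_ ?_
    · refine Metric.isOpen_iff.2 fun x hx => ?_
      obtain ⟨R, hR, -, h⟩ := hstep x hx.1
      exact ⟨R, hR, fun v hv => h x (mem_ball_self hR) v hv hx⟩
    · refine ⟨0, D.zero_mem, D.zero_mem, 1, zero_le_one, fun f => ?_⟩
      rw [one_mul, bloch_norm_def]
      exact le_add_of_nonneg_right ENNReal.toReal_nonneg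
    · rintro x ⟨hxc, hx⟩
      obtain ⟨R, hR, -, h⟩ := hstep x hx
      obtain ⟨w, hwS, hw⟩ := Metric.mem_closure_iff.1 hxc R hR
      exact h w (by rwa [mem_ball, dist_comm]) x (mem_ball_self hR) hwS
  exact (hsub hz).2

variable (D) in
/-- The unit ball of the Bloch space is locally uniformly bounded. -/
theorem exists_norm_le_blochSpace {z : Fin n → ℂ} (hz : z ∈ D.carrier) :
    ∃ R > 0, ∃ C, 0 ≤ C ∧ ball z R ⊆ D.carrier ∧
      ∀ f : BlochSpace D, ∀ w ∈ ball z R, ‖f.1 w‖ ≤ C * ‖f‖ := by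
  obtain ⟨R, hR, C, hC, hRD, h⟩ := exists_lipschitz_blochSpace D hz
  obtain ⟨C', hC', h'⟩ := exists_norm_apply_le_blochSpace D hz
  refine ⟨R, hR, C' + C * R, by positivity, hRD, fun f w hw => ?_⟩
  have h1 := norm_le_norm_add_norm_sub' (f.1 w) (f.1 z)
  have h2 := h f z (mem_ball_self hR) w hw
  have h3 : ‖w - z‖ ≤ R := (mem_ball_iff_norm.1 hw).le
  calc _ ≤ _ := h1
    _ ≤ C' * ‖f‖ + C * ‖f‖ * R := add_le_add (h' f) (h2.trans (by gcongr))
    _ = _ := by ring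

/-- Closed balls of the Bloch space are closed under locally uniform convergence. -/
theorem exists_blochSpace_of_tendstoLocallyUniformlyOn {f : ℕ → BlochSpace D} {C : ℝ}
    (hC : ∀ k, ‖f k‖ ≤ C) {g : (Fin n → ℂ) → ℂ}
    (hg : TendstoLocallyUniformlyOn (fun k z => (f k).1 z) g atTop D.carrier) :
    ∃ h : BlochSpace D, ‖h‖ ≤ C ∧ Set.EqOn h.1 g D.carrier := by
  have hderiv : ∀ z ∈ D.carrier, ∃ L : (Fin n → ℂ) →L[ℂ] ℂ,
      Tendsto (fun k => fderiv ℂ (f k).1 z) atTop (𝓝 L) ∧ HasFDerivAt g L z := by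
    intro z hz
    obtain ⟨R, hR, M, hM, hRD, hbd⟩ := exists_norm_le_blochSpace D hz
    have hsub : closedBall z (R / 2) ⊆ D.carrier :=
      (closedBall_subset_ball (by linarith)).trans hRD
    refine exists_hasFDerivAt_of_tendstoUniformlyOn (R := R / 2) (M := M * C) (by positivity)
      (fun k => (f k).1.differentiableOn.mono (ball_subset_closedBall.trans hsub))
      (fun k w hw => (hbd (f k) w (ball_subset_ball (by linarith) hw)).trans
        (by gcongr; exact hC k)) ?_
    exact ((tendstoLocallyUniformlyOn_iff_forall_isCompact D.isOpen).1 hg _ hsub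
      (isCompact_closedBall z (R / 2))).mono ball_subset_closedBall
  have hgd : DifferentiableOn ℂ g D.carrier := fun z hz =>
    let ⟨_, _, hL⟩ := hderiv z hz
    hL.differentiableAt.differentiableWithinAt
  set G : HolFun D := HolFun.ofDifferentiableOn D g hgd
  have hGg : Set.EqOn G g D.carrier := fun z hz => Set.indicator_of_mem hz g
  have hlim0 : Tendsto (fun k => ‖(f k).1 0‖) atTop (𝓝 ‖G 0‖) := by
    rw [hGg D.zero_mem]
    exact (hg.tendsto_at D.zero_mem).norm
  have h0 : 0 ≤ C - ‖G 0‖ := by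
    refine sub_nonneg.2 (le_of_tendsto' hlim0 fun k => le_trans ?_ (hC k))
    rw [bloch_norm_def]
    exact le_add_of_nonneg_right ENNReal.toReal_nonneg
  -- Passing to the limit in `β_{f_k} ≤ C - |f_k(0)|`, rather than in `β_{f_k} ≤ C`, keeps the same
  -- constant `C` for the full norm of the limit.
  have hβ : blochBeta G ≤ ENNReal.ofReal (C - ‖G 0‖) := by
    refine blochBeta_le_of_norm_fderiv_le h0 fun z hz u => ?_
    obtain ⟨L, hL, hgL⟩ := hderiv z hz
    have hGL : fderiv ℂ G z = L := by
      refine (hgL.congr_of_eventuallyEq ?_).fderiv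
      filter_upwards [D.isOpen.mem_nhds hz] with w hw using hGg hw
    rw [hGL]
    have h1 : Tendsto (fun k => ‖fderiv ℂ (f k).1 z u‖) atTop (𝓝 ‖L u‖) :=
      (((ContinuousLinearMap.apply ℂ ℂ u).continuous.tendsto L).comp hL).norm
    refine le_of_tendsto_of_tendsto' h1 ((hlim0.const_sub C).mul_const _) fun k => ?_
    refine (norm_fderiv_le_blochBeta (f k).2.ne hz u).trans ?_
    gcongr
    have := hC k
    rw [bloch_norm_def] at this
    linarith
  refine ⟨⟨G, hβ.trans_lt ENNReal.ofReal_lt_top⟩, ?_, hGg⟩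
  rw [bloch_norm_def]
  have := ENNReal.toReal_mono ENNReal.ofReal_ne_top hβ
  rw [ENNReal.toReal_ofReal h0] at this
  change ‖G 0‖ + (blochBeta G).toReal ≤ C
  linarith

/-- A bounded sequence in the Bloch space has a locally uniformly convergent subsequence, and the
limit obeys the same norm bound. -/
theorem exists_subseq_tendstoLocallyUniformlyOn {f : ℕ → BlochSpace D} {C : ℝ}
    (hC : ∀ k, ‖f k‖ ≤ C) :
    ∃ g : BlochSpace D, ‖g‖ ≤ C ∧ ∃ θ : ℕ → ℕ, StrictMono θ ∧
      TendstoLocallyUniformlyOn (fun k z => (f (θ k)).1 z) g.1 atTop D.carrier := by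
  have : LocallyCompactSpace D.carrier := D.isOpen.locallyCompactSpace
  let F : ℕ → C(D.carrier, ℂ) := fun k =>
    ⟨fun x => (f k).1 x, ((f k).1.differentiableOn.continuousOn).domRestrict⟩
  have : T2Space (UniformOnFun D.carrier ℂ {K | IsCompact K}) :=
    UniformOnFun.t2Space_of_covering (Set.eq_univ_of_forall fun x =>
      Set.mem_sUnion_of_mem (Set.mem_singleton x) isCompact_singleton)
  -- Arzelà–Ascoli: the local Lipschitz bound gives equicontinuity, and bounded evaluations give
  -- pointwise relative compactness.
  have hcompact : IsCompact (closure (Set.range F)) := by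
    refine ArzelaAscoli.isCompact_closure_of_isClosedEmbedding (𝔖 := {K | IsCompact K})
      (F := fun g : C(D.carrier, ℂ) => ⇑g) (fun K hK => hK)
      ContinuousMap.isUniformEmbedding_toUniformOnFunIsCompact.isClosedEmbedding ?_ ?_
    · intro K _
      refine Equicontinuous.equicontinuousOn (fun x => ?_) K
      rw [Metric.equicontinuousAt_iff]
      intro ε hε
      obtain ⟨R, hR, M, hM, -, h⟩ := exists_lipschitz_blochSpace D x.2
      have hC0 : 0 ≤ C := (norm_nonneg _).trans (hC 0)
      refine ⟨min R (ε / (M * C + 1)), by positivity, fun y hy => ?_⟩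
      rintro ⟨_, k, rfl⟩
      rw [dist_comm, dist_eq_norm]
      have hy1 : dist y x < R := hy.trans_le (min_le_left _ _)
      have hy2 : dist y x < ε / (M * C + 1) := hy.trans_le (min_le_right _ _)
      rw [lt_div_iff₀ (by positivity)] at hy2
      have h1 := h (f k) x (mem_ball_self hR) y hy1
      calc ‖(f k).1 y - (f k).1 x‖ ≤ M * ‖f k‖ * ‖y.1 - x.1‖ := h1
        _ ≤ M * C * dist y x := by
            rw [Subtype.dist_eq, dist_eq_norm]
            gcongr
            exact hC k
        _ < ε := by nlinarith [dist_nonneg (x := y) (y := x)]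
    · intro K _ x _
      obtain ⟨M, hM, h⟩ := exists_norm_apply_le_blochSpace D x.2
      refine ⟨closedBall 0 (M * C), isCompact_closedBall _ _, ?_⟩
      rintro _ ⟨k, rfl⟩
      rw [mem_closedBall_zero_iff]
      exact (h (f k)).trans (by gcongr; exact hC k)
  obtain ⟨G, -, θ, hθ, hlim⟩ := hcompact.tendsto_subseq (x := F)
    fun k => subset_closure ⟨k, rfl⟩
  rw [ContinuousMap.tendsto_iff_tendstoLocallyUniformly] at hlim
  classical
  let g : (Fin n → ℂ) → ℂ := fun z => if hz : z ∈ D.carrier then G ⟨z, hz⟩ else 0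
  have hg : TendstoLocallyUniformlyOn (fun k z => (f (θ k)).1 z) g atTop D.carrier := by
    rw [tendstoLocallyUniformlyOn_iff_tendstoLocallyUniformly_comp_coe]
    have : g ∘ ((↑) : D.carrier → Fin n → ℂ) = G := funext fun x => dif_pos x.2
    rw [this]
    exact hlim
  obtain ⟨h, hh, hhg⟩ := exists_blochSpace_of_tendstoLocallyUniformlyOn (fun k => hC (θ k)) hg
  exact ⟨h, hh, θ, hθ, hg.congr_right hhg.symm⟩

end BlochEstimates

/-! ### The two implications of the compactness criterion. -/

section CompactWeightedComp

open Metric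

variable {n : ℕ} {D : BoundedHomogeneousDomain n} {μ : Weight D} {ψ : HolFun D}
  {φ : HolSelfMap D}

theorem weight_mul_norm_le (h : WeightedHinf μ) {z : Fin n → ℂ} (hz : z ∈ D.carrier) :
    μ.toFun z * ‖h.1 z‖ ≤ ‖h‖ := by
  have h1 : ENNReal.ofReal (μ.toFun z) * ‖h.1 z‖ₑ ≤ muNorm μ h.1 :=
    le_iSup₂ (f := fun z _ => ENNReal.ofReal (μ.toFun z) * ‖h.1 z‖ₑ) z hz
  have h2 := ENNReal.toReal_mono h.2.ne h1
  rwa [ENNReal.toReal_mul, toReal_enorm, ENNReal.toReal_ofReal (μ.pos z hz).le] at h2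

theorem muNorm_eq_ofReal_norm (h : WeightedHinf μ) : muNorm μ h.1 = ENNReal.ofReal ‖h‖ := by
  rw [weightedHinf_norm_def, ENNReal.ofReal_toReal h.2.ne]

/-- Convergence in the weighted space implies pointwise convergence. -/
theorem tendsto_apply_of_tendsto_weightedHinf {h : ℕ → WeightedHinf μ} {g : WeightedHinf μ}
    (hh : Tendsto h atTop (𝓝 g)) {z : Fin n → ℂ} (hz : z ∈ D.carrier) :
    Tendsto (fun k => (h k).1 z) atTop (𝓝 (g.1 z)) := by
  rw [tendsto_iff_norm_sub_tendsto_zero] at hh ⊢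
  have h1 : Tendsto (fun k => (μ.toFun z)⁻¹ * ‖h k - g‖) atTop (𝓝 0) := by
    simpa using hh.const_mul (μ.toFun z)⁻¹
  refine squeeze_zero (fun _ => norm_nonneg _) (fun k => ?_) h1
  rw [le_inv_mul_iff₀ (μ.pos z hz)]
  exact weight_mul_norm_le (h k - g) hz

theorem tendsto_muNorm_of_isCompactWeightedComp (hW : IsCompactWeightedComp μ ψ φ)
    {f : ℕ → BlochSpace D} {C : ℝ} (hC : ∀ k, ‖f k‖ ≤ C)
    (hf : TendstoLocallyUniformlyOn (fun k z => (f k).1 z) (fun _ => 0) atTop D.carrier) :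
    Tendsto (fun k => muNorm μ (weightedComp ψ φ (f k).1)) atTop (𝓝 0) := by
  obtain ⟨T, hT, hcomp⟩ := hW
  obtain ⟨K, hK, hsub⟩ := hcomp.image_closedBall_subset_compact (f := T) C
  -- It suffices that each subsequence has a further subsequence tending to `0`. Compactness
  -- supplies a limit, and pointwise convergence shows that it is `0`.
  have hTf : Tendsto (fun k => T (f k)) atTop (𝓝 0) := by
    refine tendsto_of_subseq_tendsto fun ns hns => ?_
    obtain ⟨g, -, θ, hθ, hlim⟩ := hK.tendsto_subseq (x := fun k => T (f (ns k)))
      fun k => hsub ⟨f (ns k), by simpa using hC (ns k), rfl⟩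
    have hg : g = 0 := by
      refine Subtype.ext (HolFun.ext_on fun z hz => ?_)
      refine tendsto_nhds_unique (tendsto_apply_of_tendsto_weightedHinf hlim hz) ?_
      have h1 : Tendsto (fun k => ψ z * (f k).1 (φ.toFun z)) atTop (𝓝 0) := by
        simpa using (hf.tendsto_at (φ.mapsTo hz)).const_mul (ψ z)
      refine (h1.comp (hns.comp hθ.tendsto_atTop)).congr fun k => ?_
      simp only [Function.comp_apply, hT]
      rfl
    exact ⟨θ, hg ▸ hlim⟩
  have h2 : Tendsto (fun k => ENNReal.ofReal ‖T (f k)‖) atTop (𝓝 0) := by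
    simpa using ENNReal.tendsto_ofReal hTf.norm
  refine h2.congr fun k => ?_
  rw [← muNorm_eq_ofReal_norm, hT]

/-- The sequential condition characterising compactness of `W_{ψ,φ}`. -/
def MapsNullSequencesToNull (μ : Weight D) (ψ : HolFun D) (φ : HolSelfMap D) : Prop :=
  ∀ f : ℕ → BlochSpace D, (∃ C : ℝ, ∀ k, ‖f k‖ ≤ C) →
    TendstoLocallyUniformlyOn (fun k z => (f k : HolFun D) z) (fun _ => 0) atTop D.carrier →
    Tendsto (fun k => muNorm μ (weightedComp ψ φ (f k : HolFun D))) atTop (𝓝 0)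

/-- The multiples `f / (k + 1)` form a bounded null sequence. One of their images thus has finite
norm, and scaling back gives the image of `f`. -/
theorem MapsNullSequencesToNull.mem_weightedHinf (hW : MapsNullSequencesToNull μ ψ φ)
    (f : BlochSpace D) : weightedComp ψ φ f.1 ∈ WeightedHinf μ := by
  set c : ℕ → ℂ := fun k => 1 / ((k : ℂ) + 1)
  have hc : Tendsto c atTop (𝓝 0) := tendsto_one_div_add_atTop_nhds_zero_nat
  have hlim := hW (fun k => c k • f) ?_ ?_
  · obtain ⟨k, hk⟩ := (hlim.eventually_lt_const ENNReal.zero_lt_top).exists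
    have hck : c k ≠ 0 := one_div_ne_zero (Nat.cast_add_one_ne_zero k)
    have h1 : weightedComp ψ φ (c k • f : BlochSpace D).1 ∈ WeightedHinf μ := hk
    rw [Submodule.coe_smul, map_smul] at h1
    exact (Submodule.smul_mem_iff _ hck).1 h1
  · obtain ⟨M, hM⟩ := (isBounded_range_of_tendsto c hc).exists_norm_le
    refine ⟨M * ‖f‖, fun k => ?_⟩
    rw [norm_smul]
    gcongr
    exact hM _ ⟨k, rfl⟩
  · rw [Metric.tendstoLocallyUniformlyOn_iff]
    intro ε hε x hx
    have h1 : ∀ᶠ y in 𝓝 x, ‖f.1 y‖ < ‖f.1 x‖ + 1 :=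
      (f.1.differentiableAt hx).continuousAt.norm.eventually_lt_const (lt_add_one _)
    refine ⟨_, mem_nhdsWithin_of_mem_nhds h1, ?_⟩
    have h2 : Tendsto (fun k => ‖c k‖ * (‖f.1 x‖ + 1)) atTop (𝓝 0) := by
      simpa using hc.norm.mul_const (‖f.1 x‖ + 1)
    filter_upwards [h2.eventually_lt_const hε] with k hk y hy
    rw [dist_zero_left]
    calc ‖c k * f.1 y‖ = ‖c k‖ * ‖f.1 y‖ := norm_mul _ _
      _ ≤ ‖c k‖ * (‖f.1 x‖ + 1) := by gcongr
      _ < ε := hk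

theorem MapsNullSequencesToNull.isCompactWeightedComp (hW : MapsNullSequencesToNull μ ψ φ) :
    IsCompactWeightedComp μ ψ φ := by
  let T : BlochSpace D →ₗ[ℂ] WeightedHinf μ :=
    ((weightedComp ψ φ).comp (BlochSpace D).subtype).codRestrict (WeightedHinf μ)
      hW.mem_weightedHinf
  refine ⟨T, fun _ => rfl, ?_⟩
  rw [isCompactOperator_iff_image_closedBall_subset_compact T one_pos]
  -- The image of the closed unit ball is itself compact: the limit `g` of the preimages stays in
  -- that ball.
  refine ⟨_, IsSeqCompact.isCompact ?_, subset_rfl⟩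
  intro y hy
  choose f hf hfy using hy
  have hf1 : ∀ k, ‖f k‖ ≤ 1 := fun k => mem_closedBall_zero_iff.1 (hf k)
  obtain ⟨g, hg, θ, hθ, hlim⟩ := exists_subseq_tendstoLocallyUniformlyOn hf1
  refine ⟨T g, ⟨g, mem_closedBall_zero_iff.2 hg, rfl⟩, θ, hθ, ?_⟩
  have hnull := hW (fun k => f (θ k) - g) ⟨2, fun k => ?_⟩ ?_
  · rw [tendsto_iff_norm_sub_tendsto_zero]
    have h1 := (ENNReal.tendsto_toReal ENNReal.zero_ne_top).comp hnull
    refine h1.congr fun k => ?_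
    rw [Function.comp_apply, Function.comp_apply, ← hfy, ← map_sub]
    rfl
  · linarith [norm_sub_le (f (θ k)) g, hf1 (θ k)]
  · rw [Metric.tendstoLocallyUniformlyOn_iff] at hlim ⊢
    intro ε hε x hx
    obtain ⟨t, ht, h⟩ := hlim ε hε x hx
    refine ⟨t, ht, h.mono fun k hk y hy => ?_⟩
    have := hk y hy
    rw [dist_comm, dist_eq_norm] at this
    rw [dist_zero_left]
    exact this

end CompactWeightedComp

end BlochWCO

end

theorem mainTheorem6 {n : ℕ} (D : BlochWCO.BoundedHomogeneousDomain n) (μ : BlochWCO.Weight D)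
    (ψ : BlochWCO.HolFun D) (φ : BlochWCO.HolSelfMap D) :
    BlochWCO.IsCompactWeightedComp μ ψ φ ↔
      ∀ f : ℕ → BlochWCO.BlochSpace D,
        (∃ C : ℝ, ∀ k, ‖f k‖ ≤ C) →
        TendstoLocallyUniformlyOn (fun k z => (f k : BlochWCO.HolFun D) z) (fun _ => 0)
          atTop D.carrier →
        Tendsto (fun k => BlochWCO.muNorm μ
          (BlochWCO.weightedComp ψ φ (f k : BlochWCO.HolFun D))) atTop (𝓝 0) :=
  ⟨fun hW _ ⟨_, hC⟩ hf => BlochWCO.tendsto_muNorm_of_isCompactWeightedComp hW hC hf,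
    fun hW => BlochWCO.MapsNullSequencesToNull.isCompactWeightedComp hW⟩
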